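/- Let $X$ and $Z$ be Banach spaces (over $\mathbb{K}=\mathbb{R}$ or $\mathbb{C}$) with $Z\supseteq X$ isometrically, let $\lambda\ge 1$ and $1<p\le\infty$, and let $q$ be given by $\frac1p+\frac1q=1$. Suppose that $X$ has the metric approximation property, in the following sense: for every compact $K\subseteq X$ and every $\varepsilon>0$ there is a bounded finite-rank operator $R:X\to X$ with $\sup_{x\in K}\|Rx-x\|\le\varepsilon$ (no bound on $\|R\|$ is required, so the variant with $\|R\|\le 1$ is covered). Definitions. Let $Y$ be a Banach space. For $p<\infty$, $\ell_p^s(Y)$ is the space of sequences $y=(y_n)$ in $Y$ with $\|y\|_p^s=\big(\sum_n\|y_n\|^p\big)^{1/p}<\infty$, and $\ell_p^w(Y)$ is the space of sequences with $\sum_n|y^*(y_n)|^p<\infty$ for all $y^*\in Y^*$, with the norm $\|y\|_p^w=\sup_{y^*\in B_{Y^*}}\big(\sum_n|y^*(y_n)|^p\big)^{1/p}$. For $p=\infty$ they are replaced by the norm-null sequences $c_0^s(Y)$ and by the weakly null sequences $c_0^w(Y)$, respectively, both with the norm $\|y\|_\infty^s=\|y\|_\infty^w=\sup_n\|y_n\|$.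 For such $y$ put $E_y(\alpha)=\sum_n\alpha_ny_n$, $\alpha\in\ell_q$. A set $A\subseteq Y$ is relatively $p$-compact (relatively weakly $p$-compact) if $A\subseteq E_y(B_{\ell_q})$ for some $y\in\ell_p^s(Y)$ (some $y\in\ell_p^w(Y)$), with $c_0^s(Y)$ ($c_0^w(Y)$) instead for $p=\infty$. A bounded operator is $p$-compact (weakly $p$-compact) if it maps bounded sets to relatively $p$-compact (relatively weakly $p$-compact) sets. For a bounded operator $T:W\to Y$ from a Banach space $W$, $\kappa_p(T)$ is the infimum of $\|y\|_p^s$, and $\omega_p(T)$ the infimum of $\|y\|_p^w$, over all such $y$ (of the strong, respectively the weak, kind) with $T(B_W)\subseteq E_y(B_{\ell_q})$. (a) Suppose that for every Banach space $Y$, every compact operator $T:X\to Y$ has a compact extension $\widetilde T:Z\to Y$ with $\|\widetilde T\|\le\lambda\|T\|$. Then for every Banach space $Y$, every $p$-compact operator $S:X\to Y$ has a $p$-compact extension $\widetilde S:Z\to Y$ with $\kappa_p(\widetilde S)\le\lambda\,\kappa_p(S)$. (b) Suppose that for every Banach space $Y$, every weakly compact operator $T:X\to Y$ has a weakly compact extension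 $\widetilde T:Z\to Y$ with $\|\widetilde T\|\le\lambda\|T\|$. Then for every Banach space $Y$, every weakly $p$-compact operator $S:X\to Y$ has a weakly $p$-compact extension $\widetilde S:Z\to Y$ with $\omega_p(\widetilde S)\le\lambda\,\omega_p(S)$. -/

import Mathlib

open Filter Topology Set
open scoped ENNReal

universe u v

noncomputable section

section PCompact

variable (𝕜 : Type v) [RCLike 𝕜]
variable {X Y : Type u} [NormedAddCommGroup X] [NormedSpace 𝕜 X]
  [NormedAddCommGroup Y] [NormedSpace 𝕜 Y]

/-- Every compact subset of `X` is moved arbitrarily little by some bounded finite-rank operator: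
the identity is approximated, uniformly on compact sets, by finite-rank operators. No bound on the
norms of these operators is required, so this is implied by (and is formally weaker than) the
variant in which they are asked to be contractions. -/
def HasMAP (X : Type u) [NormedAddCommGroup X] [NormedSpace 𝕜 X] : Prop :=
  ∀ K : Set X, IsCompact K → ∀ ε : ℝ, 0 < ε →
    ∃ R : X →L[𝕜] X, FiniteDimensional 𝕜 (LinearMap.range (R : X →ₗ[𝕜] X)) ∧
      ∀ x ∈ K, ‖R x - x‖ ≤ ε

/-- Weakly compact operators: the image of the closed unit ball is relatively compact for the weak
topology of `Y`. -/
def IsWeaklyCompactOperator (T : X →L[𝕜] Y) : Prop :=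
  ∃ K : Set (WeakSpace 𝕜 Y), IsCompact K ∧
    ∀ x ∈ Metric.closedBall (0 : X) 1, toWeakSpace 𝕜 Y (T x) ∈ K

/-- `E_y(B_{ℓ_q})`, where `E_y α = ∑ αₙ yₙ` and `1/p + 1/q = 1`. For the sequences `y` considered
below and `1 < p ≤ ∞` this series converges unconditionally for every `α ∈ ℓ_q`. -/
def lpBallImage (p : ℝ≥0∞) (y : ℕ → Y) : Set Y :=
  {v | ∃ α : lp (fun _ : ℕ => 𝕜) p.conjExponent, ‖α‖ ≤ 1 ∧ HasSum (fun n => α n • y n) v}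

/-- `y ∈ ℓ_p^s(Y)` for `p < ∞`, and `y ∈ c_0^s(Y)` (norm-null sequences) for `p = ∞`. -/
def StronglySummable (p : ℝ≥0∞) (y : ℕ → Y) : Prop :=
  Memℓp y p ∧ (p = ∞ → Tendsto y atTop (𝓝 0))

/-- `‖y‖_p^s = (∑ ‖yₙ‖ᵖ)^(1/p)`, and `supₙ ‖yₙ‖` for `p = ∞`. -/
def strongNorm (p : ℝ≥0∞) (y : ℕ → Y) (hy : StronglySummable p y) : ℝ≥0∞ :=
  ENNReal.ofReal ‖(⟨y, hy.1⟩ : lp (fun _ : ℕ => Y) p)‖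

/-- `y ∈ ℓ_p^w(Y)` for `p < ∞`, and `y ∈ c_0^w(Y)` (weakly null sequences) for `p = ∞`. -/
def WeaklySummable (p : ℝ≥0∞) (y : ℕ → Y) : Prop :=
  ∀ f : Y →L[𝕜] 𝕜, Memℓp (fun n => f (y n)) p ∧
    (p = ∞ → Tendsto (fun n => f (y n)) atTop (𝓝 0))

/-- `‖y‖_p^w = sup {(∑ |f(yₙ)|ᵖ)^(1/p) : f ∈ B_{Y*}}`, and
`sup {supₙ |f(yₙ)| : f ∈ B_{Y*}} = supₙ ‖yₙ‖` for `p = ∞`. -/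
def weakNorm (p : ℝ≥0∞) (y : ℕ → Y) (hy : WeaklySummable 𝕜 p y) : ℝ≥0∞ :=
  ⨆ f : Y →L[𝕜] 𝕜, ⨆ _ : ‖f‖ ≤ 1,
    ENNReal.ofReal ‖(⟨fun n => f (y n), (hy f).1⟩ : lp (fun _ : ℕ => 𝕜) p)‖

/-- Relatively `p`-compact sets. -/
def IsRelPCompact (p : ℝ≥0∞) (K : Set Y) : Prop :=
  ∃ y : ℕ → Y, StronglySummable p y ∧ K ⊆ lpBallImage 𝕜 p y

/-- Relatively weakly `p`-compact sets. -/
def IsRelWeaklyPCompact (p : ℝ≥0∞) (K : Set Y) : Prop :=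
  ∃ y : ℕ → Y, WeaklySummable 𝕜 p y ∧ K ⊆ lpBallImage 𝕜 p y

/-- `p`-compact operators: bounded sets are mapped to relatively `p`-compact sets. -/
def IsPCompactOperator (p : ℝ≥0∞) (T : X →L[𝕜] Y) : Prop :=
  ∀ A : Set X, Bornology.IsBounded A → IsRelPCompact 𝕜 p (T '' A)

/-- Weakly `p`-compact operators: bounded sets are mapped to relatively weakly `p`-compact sets. -/
def IsWeaklyPCompactOperator (p : ℝ≥0∞) (T : X →L[𝕜] Y) : Prop :=
  ∀ A : Set X, Bornology.IsBounded A → IsRelWeaklyPCompact 𝕜 p (T '' A)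

/-- `κ_p(T) = inf {‖y‖_p^s : T(B_X) ⊆ E_y(B_{ℓ_q})}`; it is `∞` if `T` is not `p`-compact. -/
def kappaNorm (p : ℝ≥0∞) (T : X →L[𝕜] Y) : ℝ≥0∞ :=
  ⨅ (y : ℕ → Y) (hy : StronglySummable p y)
    (_ : T '' Metric.closedBall 0 1 ⊆ lpBallImage 𝕜 p y), strongNorm p y hy

/-- `ω_p(T) = inf {‖y‖_p^w : T(B_X) ⊆ E_y(B_{ℓ_q})}`; it is `∞` if `T` is not weakly
`p`-compact. -/
def omegaNorm (p : ℝ≥0∞) (T : X →L[𝕜] Y) : ℝ≥0∞ :=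
  ⨅ (y : ℕ → Y) (hy : WeaklySummable 𝕜 p y)
    (_ : T '' Metric.closedBall 0 1 ⊆ lpBallImage 𝕜 p y), weakNorm 𝕜 p y hy

end PCompact

end

/-!
The extension property controls only a norm, whereas `κ_p` and `ω_p` measure how the image of the
unit ball sits inside the sets `E_y (B_{ℓ_q})`. The bridge is a renorming of the target. For a
compact or weakly compact `S : X → Y` and `ε > 0`, renorm `Y` so that its unit ball is essentially
`S (B_X) + ε • B_Y` (`exists_renorming`). The operator `S` then has norm at most one and keeps its
compactness, so it extends to `T_ε : Z → Y` with `T_ε (B_Z)` contained in `lam • S (B_X)` up to an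
error of order `ε` (`exists_approx_extension`).

Let `ε → 0` along an ultrafilter. As `S (B_X)` is relatively weakly compact, the `T_ε` converge
weakly, pointwise on `Z`, to an extension `S'` of `S`, and every weakly compact `L ⊇ S (B_X)`
satisfies `S' (B_Z) ⊆ lam • L` (`exists_extension_of_approx`).

The sets `L = E_y (B_{ℓ_q})` qualify: they are images of the unit ball of `ℓ_q`, which is compact
for pointwise convergence because `q < ∞`, under a map that is continuous into the weak topology
(`WeaklySummable.isCompact_toWeakSpace_lpBallImage`), and into the norm topology if `y` is strongly
summable (`StronglySummable.isCompact_lpBallImage`). Hence `p`-compact operators are compact and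
weakly `p`-compact ones are weakly compact. Since one and the same `S'` serves for all `y` with
`S (B_X) ⊆ E_y (B_{ℓ_q})`, the infima that define `κ_p` and `ω_p` compare with the exact constant
`lam`, although they need not be attained.
-/

open Filter Topology Set
open scoped ENNReal

noncomputable section

/-! ### Extensions with control of the image of the unit ball -/

section WeakLimit

variable {𝕜 : Type v} [RCLike 𝕜]
variable {X Y Z : Type u} [NormedAddCommGroup X] [NormedSpace 𝕜 X]
  [NormedAddCommGroup Y] [NormedSpace 𝕜 Y] [NormedAddCommGroup Z] [NormedSpace 𝕜 Z]

/-- A sequence in a weakly compact set converges weakly, within the set, along any ultrafilter. -/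
theorem IsCompact.exists_weak_ultralimit {K : Set (WeakSpace 𝕜 Y)} (hK : IsCompact K)
    (U : Ultrafilter ℕ) (s : ℕ → Y) (hs : ∀ n, toWeakSpace 𝕜 Y (s n) ∈ K) :
    ∃ k : Y, toWeakSpace 𝕜 Y k ∈ K ∧
      ∀ f : Y →L[𝕜] 𝕜, Tendsto (fun n => f (s n)) U (𝓝 (f k)) := by
  obtain ⟨k, hkK, hk⟩ := hK.ultrafilter_le_nhds (U.map fun n => toWeakSpace 𝕜 Y (s n))
    (le_principal_iff.2 (Filter.mem_map.2 (univ_mem' hs)))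
  refine ⟨(toWeakSpace 𝕜 Y).symm k, by simpa using hkK, fun f => ?_⟩
  have h1 : Tendsto (fun n => toWeakSpace 𝕜 Y (s n)) U (𝓝 k) := hk
  exact ((WeakBilin.eval_continuous (topDualPairing 𝕜 Y).flip f).tendsto k).comp h1

theorem eq_of_forall_dual {a b : Y} (h : ∀ f : Y →L[𝕜] 𝕜, f a = f b) : a = b :=
  (SeparatingDual.eq_iff_forall_dual_eq (R := 𝕜)).2 h

/-- A weak limit of approximate extensions. If `S` maps the unit ball into a weakly compact set and
has extensions to `Z` whose value at each `z` is arbitrarily close to some `lam • S x` with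
`‖x‖ ≤ ‖z‖`, then it has an extension `S'` for which every weakly compact set containing `S (B_X)`
contains `S' (B_Z)` up to the factor `lam`. -/
theorem exists_extension_of_approx (i : X →ₗᵢ[𝕜] Z) (S : X →L[𝕜] Y)
    (hS : IsWeaklyCompactOperator 𝕜 S) {lam : ℝ} (hlam : 0 ≤ lam)
    (happ : ∀ ε : ℝ, 0 < ε → ∃ T : Z →L[𝕜] Y, (∀ x, T (i x) = S x) ∧
      ∀ z, ∃ x : X, ‖x‖ ≤ ‖z‖ ∧ ‖T z - (lam : 𝕜) • S x‖ ≤ ε * (‖z‖ + 1)) :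
    ∃ S' : Z →L[𝕜] Y, (∀ x, S' (i x) = S x) ∧
      ∀ L : Set (WeakSpace 𝕜 Y), IsCompact L →
        (∀ x ∈ Metric.closedBall (0 : X) 1, toWeakSpace 𝕜 Y (S x) ∈ L) →
        ∀ z ∈ Metric.closedBall (0 : Z) 1,
          ∃ v, toWeakSpace 𝕜 Y v ∈ L ∧ S' z = (lam : 𝕜) • v := by
  obtain ⟨K, hK, hSK⟩ := hS
  have happ' : ∀ n : ℕ, ∃ T : Z →L[𝕜] Y, (∀ x, T (i x) = S x) ∧
      ∀ z, ∃ x : X, ‖x‖ ≤ ‖z‖ ∧ ‖T z - (lam : 𝕜) • S x‖ ≤ 1 / ((n : ℝ) + 1) * (‖z‖ + 1) :=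
    fun n => happ _ (by positivity)
  choose T hTi hT using happ'
  choose x hx hTx using hT
  let U : Ultrafilter ℕ := hyperfilter ℕ
  have hU : (U : Filter ℕ) ≤ atTop := Nat.hyperfilter_le_atTop
  -- the points `S (x n z)` stay in the weakly compact set `‖z‖ • K`
  have hlim : ∀ z, ∃ k : Y, ∀ f : Y →L[𝕜] 𝕜,
      Tendsto (fun n => f (S (x n z))) U (𝓝 (f k)) := by
    intro z
    have hKz : IsCompact ((fun v : WeakSpace 𝕜 Y => (‖z‖ : 𝕜) • v) '' K) :=
      hK.image (continuous_const_smul _)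
    obtain ⟨k, -, hk⟩ := hKz.exists_weak_ultralimit U (fun n => S (x n z)) (fun n => by
      rcases eq_or_ne ‖z‖ 0 with h0 | h0
      · have : x n z = 0 := by
          have := hx n z
          rw [h0] at this
          exact norm_le_zero_iff.1 this
        exact ⟨_, hSK 0 (by simp), by simp [h0, this]⟩
      · refine ⟨_, hSK ((‖z‖ : 𝕜)⁻¹ • x n z) ?_, ?_⟩
        · rw [mem_closedBall_zero_iff, norm_smul, norm_inv, RCLike.norm_ofReal, abs_norm,
            inv_mul_le_one₀ (lt_of_le_of_ne (norm_nonneg z) h0.symm)]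
          exact hx n z
        · have h0' : (‖z‖ : 𝕜) ≠ 0 := by exact_mod_cast h0
          simp only [map_smul]
          rw [smul_inv_smul₀ h0'])
    exact ⟨k, hk⟩
  choose k hk using hlim
  -- and `T n z` is asymptotically `lam • S (x n z)`
  have hTk : ∀ z (f : Y →L[𝕜] 𝕜), Tendsto (fun n => f (T n z)) U (𝓝 (f ((lam : 𝕜) • k z))) := by
    intro z f
    have h0 : Tendsto (fun n => T n z - (lam : 𝕜) • S (x n z)) U (𝓝 0) := by
      refine squeeze_zero_norm (fun n => hTx n z) (Tendsto.mono_left ?_ hU)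
      simpa using (tendsto_one_div_add_atTop_nhds_zero_nat (𝕜 := ℝ)).mul_const (‖z‖ + 1)
    have h1 := ((f.continuous.tendsto 0).comp h0).add ((hk z f).const_smul (lam : 𝕜))
    simpa [Function.comp_def] using h1
  let A : Z →ₗ[𝕜] Y :=
    { toFun := fun z => (lam : 𝕜) • k z
      map_add' := fun z w => eq_of_forall_dual fun f => by
        refine tendsto_nhds_unique (hTk (z + w) f) ?_
        simpa using (hTk z f).add (hTk w f)
      map_smul' := fun c z => eq_of_forall_dual fun f => by
        refine tendsto_nhds_unique (hTk (c • z) f) ?_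
        simpa using (hTk z f).const_mul c }
  have hA : ∀ z, ‖A z‖ ≤ lam * ‖S‖ * ‖z‖ := by
    intro z
    refine NormedSpace.norm_le_dual_bound 𝕜 _ (by positivity) fun f => ?_
    have h1 := ((hk z f).const_smul (lam : 𝕜)).norm
    have h2 : ‖(lam : 𝕜) • f (k z)‖ ≤ lam * ‖S‖ * ‖z‖ * ‖f‖ := by
      refine le_of_tendsto h1 (univ_mem' fun n => ?_)
      change ‖(lam : 𝕜) • f (S (x n z))‖ ≤ _
      rw [norm_smul, RCLike.norm_ofReal, abs_of_nonneg hlam]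
      calc lam * ‖f (S (x n z))‖ ≤ lam * (‖f‖ * (‖S‖ * ‖z‖)) := by
            gcongr
            refine (f.le_opNorm _).trans ?_
            gcongr
            refine (S.le_opNorm _).trans ?_
            gcongr
            exact hx n z
        _ = _ := by ring
    simpa [A] using h2
  refine ⟨A.mkContinuous _ hA, fun y => eq_of_forall_dual (𝕜 := 𝕜) fun f => ?_,
    fun L hL hSL z hz => ?_⟩
  · refine tendsto_nhds_unique (hTk (i y) f) ?_
    simp [hTi]
  · obtain ⟨v, hvL, hv⟩ := hL.exists_weak_ultralimit U (fun n => S (x n z)) fun n =>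
      hSL _ (mem_closedBall_zero_iff.2 ((hx n z).trans (mem_closedBall_zero_iff.1 hz)))
    refine ⟨v, hvL, ?_⟩
    rw [eq_of_forall_dual (𝕜 := 𝕜) fun f => tendsto_nhds_unique (hv f) (hk z f)]
    rfl

/-- The identity of `Y` factors through a renorming of `Y`, presented as a quotient `W` of `X × Y`,
whose unit ball is, up to closure, `S (B_X) + ε • B_Y`. -/
theorem exists_renorming [CompleteSpace X] [CompleteSpace Y] (S : X →L[𝕜] Y) {ε : ℝ} (hε : 0 < ε) :
    ∃ (W : Type u) (_ : NormedAddCommGroup W) (_ : NormedSpace 𝕜 W) (_ : CompleteSpace W)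
      (j : Y →L[𝕜] W) (Q : W →L[𝕜] Y), (∀ y, Q (j y) = y) ∧ ‖j ∘L S‖ ≤ 1 ∧
      ∀ (w : W) (δ : ℝ), 0 < δ →
        ∃ x y, ‖x‖ < ‖w‖ + δ ∧ ‖y‖ < ‖w‖ + δ ∧ Q w = S x + (ε : 𝕜) • y := by
  let B : X × Y →L[𝕜] Y := S.coprod ((ε : 𝕜) • ContinuousLinearMap.id 𝕜 Y)
  have hB : ∀ a, B a = S a.1 + (ε : 𝕜) • a.2 := fun a => by simp [B]
  let N : Submodule 𝕜 (X × Y) := B.ker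
  have : IsClosed (N : Set (X × Y)) := B.isClosed_ker
  have hε' : (ε : 𝕜) ≠ 0 := by exact_mod_cast hε.ne'
  let j : Y →L[𝕜] (X × Y) ⧸ N :=
    N.mkQL ∘L (ContinuousLinearMap.inr 𝕜 X Y ∘L ((ε : 𝕜)⁻¹ • ContinuousLinearMap.id 𝕜 Y))
  refine ⟨(X × Y) ⧸ N, inferInstance, inferInstance, inferInstance, j, N.liftQL B le_rfl,
    fun y => ?_, ?_, fun w δ hδ => ?_⟩
  · change B (0, (ε : 𝕜)⁻¹ • y) = y
    simp [hB, smul_inv_smul₀ hε']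
  · refine ContinuousLinearMap.opNorm_le_bound _ zero_le_one fun x => ?_
    have : (j ∘L S) x = Submodule.Quotient.mk (p := N) (x, 0) := by
      change Submodule.Quotient.mk (p := N) (0, (ε : 𝕜)⁻¹ • S x) = _
      rw [Submodule.Quotient.eq]
      change B _ = 0
      simp [hB, smul_inv_smul₀ hε']
    rw [this, one_mul]
    exact (Submodule.Quotient.norm_mk_le _ _).trans (by simp [Prod.norm_def])
  · obtain ⟨a, rfl, ha⟩ := Submodule.Quotient.norm_mk_lt w hδ
    exact ⟨a.1, a.2, (norm_fst_le a).trans_lt ha, (norm_snd_le a).trans_lt ha, hB a⟩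

/-- Norm-controlled extensions of all the operators `j ∘ S`, in particular of `S` into the renormings
of `exists_renorming`, yield approximate extensions of `S` with control of the image of the ball. -/
theorem exists_approx_extension [CompleteSpace X] [CompleteSpace Y] (i : X →ₗᵢ[𝕜] Z)
    (S : X →L[𝕜] Y) {lam : ℝ} (hlam : 1 ≤ lam)
    (hext : ∀ (W : Type u) [NormedAddCommGroup W] [NormedSpace 𝕜 W] [CompleteSpace W]
      (j : Y →L[𝕜] W), ∃ T : Z →L[𝕜] W, (∀ x, T (i x) = j (S x)) ∧ ‖T‖ ≤ lam * ‖j ∘L S‖)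
    {ε : ℝ} (hε : 0 < ε) :
    ∃ T : Z →L[𝕜] Y, (∀ x, T (i x) = S x) ∧
      ∀ z, ∃ x : X, ‖x‖ ≤ ‖z‖ ∧ ‖T z - (lam : 𝕜) • S x‖ ≤ ε * (‖z‖ + 1) := by
  have hlam0 : 0 < lam := by linarith
  obtain ⟨δ, hδ, hδε⟩ : ∃ δ : ℝ, 0 < δ ∧ δ * (‖S‖ + lam + δ) ≤ ε := by
    refine ⟨min 1 (ε / (‖S‖ + lam + 1)), by positivity, ?_⟩
    calc _ ≤ ε / (‖S‖ + lam + 1) * (‖S‖ + lam + 1) := by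
          gcongr
          · exact min_le_right _ _
          · exact min_le_left _ _
      _ = ε := div_mul_cancel₀ _ (by positivity)
  obtain ⟨W, _, _, _, j, Q, hQj, hjS, hQ⟩ := exists_renorming S hδ
  obtain ⟨T, hTi, hT⟩ := hext W j
  refine ⟨Q ∘L T, fun x => by simp [hTi, hQj], fun z => ?_⟩
  obtain ⟨x, y, hx, hy, hxy⟩ := hQ (T z) δ hδ
  have hTz : ‖T z‖ ≤ lam * ‖z‖ := by
    refine (T.le_opNorm z).trans ?_
    gcongr
    nlinarith
  have hz := norm_nonneg z
  -- rescale `x`, whose norm is below `lam * ‖z‖ + δ`, to norm at most `‖z‖`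
  obtain ⟨x', hx', hxx'⟩ : ∃ x' : X, ‖x'‖ ≤ ‖z‖ ∧ ‖x - (lam : 𝕜) • x'‖ ≤ δ := by
    set t : ℝ := ‖z‖ / (lam * ‖z‖ + δ) with ht
    have hD : 0 < lam * ‖z‖ + δ := by positivity
    have ht0 : 0 ≤ t := by positivity
    have hxD : ‖x‖ ≤ lam * ‖z‖ + δ := by linarith
    have htD : t * (lam * ‖z‖ + δ) = ‖z‖ := div_mul_cancel₀ _ hD.ne'
    have hlt : 1 - lam * t = δ / (lam * ‖z‖ + δ) := by
      rw [ht]; field_simp; ring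
    refine ⟨(t : 𝕜) • x, ?_, ?_⟩
    · rw [norm_smul, RCLike.norm_ofReal, abs_of_nonneg ht0, ← htD]
      gcongr
    · have h1 : x - (lam : 𝕜) • (t : 𝕜) • x = ((1 - lam * t : ℝ) : 𝕜) • x := by
        push_cast
        rw [sub_smul, one_smul, smul_smul]
      rw [h1, norm_smul, RCLike.norm_ofReal, hlt, abs_of_nonneg (by positivity)]
      calc δ / (lam * ‖z‖ + δ) * ‖x‖ ≤ δ / (lam * ‖z‖ + δ) * (lam * ‖z‖ + δ) := by gcongr
        _ = δ := div_mul_cancel₀ _ hD.ne'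
  refine ⟨x', hx', ?_⟩
  have h2 : (Q ∘L T) z - (lam : 𝕜) • S x' = S (x - (lam : 𝕜) • x') + (δ : 𝕜) • y := by
    simp only [ContinuousLinearMap.comp_apply, hxy, map_sub, map_smul]
    abel
  rw [h2]
  calc _ ≤ ‖S‖ * δ + δ * (lam * ‖z‖ + δ) := by
        refine (norm_add_le _ _).trans (add_le_add ?_ ?_)
        · refine (S.le_opNorm _).trans ?_
          gcongr
        · rw [norm_smul, RCLike.norm_ofReal, abs_of_pos hδ]
          gcongr
          linarith
    _ ≤ δ * (‖S‖ + lam + δ) * (‖z‖ + 1) := by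
        have : 0 ≤ δ * (‖S‖ * ‖z‖ + lam + δ * ‖z‖) := by positivity
        nlinarith
    _ ≤ ε * (‖z‖ + 1) := by gcongr

end WeakLimit

/-! ### Compactness of `E_y (B_{ℓ_q})` -/

section Sequences

variable {𝕜 : Type v} [RCLike 𝕜]
variable {Y : Type u} [NormedAddCommGroup Y]

theorem ENNReal.conjExponent_ne_top {p : ℝ≥0∞} (hp : 1 < p) : p.conjExponent ≠ ∞ := by
  simpa [ENNReal.conjExponent] using (tsub_pos_of_lt hp).ne'

theorem ENNReal.one_le_toReal_conjExponent {p : ℝ≥0∞} (hp : 1 < p) :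
    1 ≤ p.conjExponent.toReal := by
  rw [← ENNReal.toReal_one]
  exact ENNReal.toReal_mono (ENNReal.conjExponent_ne_top hp) le_self_add

variable (𝕜) in
/-- The closed unit ball of `ℓ_q` as a set of scalar sequences, to be used with the topology of
pointwise convergence. -/
def ellBall (q : ℝ) : Set (ℕ → 𝕜) :=
  {α | ∀ F : Finset ℕ, ∑ n ∈ F, ‖α n‖ ^ q ≤ 1}

theorem norm_apply_le_one_of_mem_ellBall {q : ℝ} (hq : 1 ≤ q) {α : ℕ → 𝕜} (hα : α ∈ ellBall 𝕜 q)
    (n : ℕ) : ‖α n‖ ≤ 1 := by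
  have := hα {n}
  rw [Finset.sum_singleton] at this
  by_contra! h
  exact absurd this (not_le.2 (Real.one_lt_rpow h (by linarith)))

theorem isCompact_ellBall {q : ℝ} (hq : 1 ≤ q) : IsCompact (ellBall 𝕜 q) := by
  have hcpt : IsCompact (Set.univ.pi fun _ : ℕ => Metric.closedBall (0 : 𝕜) 1) :=
    isCompact_univ_pi fun _ => isCompact_closedBall _ _
  refine hcpt.of_isClosed_subset ?_ fun α hα n _ => ?_
  · have : ellBall 𝕜 q = ⋂ F : Finset ℕ, {α | ∑ n ∈ F, ‖α n‖ ^ q ≤ 1} := by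
      ext; simp [ellBall]
    rw [this]
    refine isClosed_iInter fun F => isClosed_le ?_ continuous_const
    exact continuous_finsetSum _ fun n _ =>
      (continuous_apply n).norm.rpow_const fun _ => Or.inr (by linarith)
  · exact mem_closedBall_zero_iff.2 (norm_apply_le_one_of_mem_ellBall hq hα n)

/-- The tails of `∑ ‖αₙ‖ ‖yₙ‖` are small, uniformly for `α` in the unit ball of `ℓ_q`: Hölder's
inequality if `p < ∞`, and `yₙ → 0` if `p = ∞`. -/
theorem StronglySummable.exists_tail_le {p : ℝ≥0∞} (hp : 1 < p) {y : ℕ → Y}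
    (hy : StronglySummable p y) {ε : ℝ} (hε : 0 < ε) :
    ∃ N, ∀ α ∈ ellBall 𝕜 p.conjExponent.toReal, ∀ F : Finset ℕ, (∀ n ∈ F, N ≤ n) →
      ∑ n ∈ F, ‖α n‖ * ‖y n‖ ≤ ε := by
  rcases eq_or_ne p ∞ with rfl | hpt
  · obtain ⟨N, hN⟩ := Metric.tendsto_atTop.1 (hy.2 rfl) ε hε
    refine ⟨N, fun α hα F hF => ?_⟩
    have h1 : ∑ n ∈ F, ‖α n‖ ≤ 1 := by simpa [ENNReal.conjExponent] using hα F
    calc ∑ n ∈ F, ‖α n‖ * ‖y n‖ ≤ ∑ n ∈ F, ‖α n‖ * ε := by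
          gcongr with n hn
          simpa using (hN n (hF n hn)).le
      _ = (∑ n ∈ F, ‖α n‖) * ε := by rw [Finset.sum_mul]
      _ ≤ 1 * ε := by gcongr
      _ = ε := one_mul _
  · have hp0 : 0 < p.toReal := ENNReal.toReal_pos (by positivity) hpt
    have hconj : p.conjExponent.toReal.HolderConjugate p.toReal := by
      have h1 : p.HolderConjugate p.conjExponent := .conjExponent hp.le
      exact (ENNReal.HolderConjugate.toReal_of_ne_top (ENNReal.conjExponent_ne_top hp) hpt : _)
    obtain ⟨s, hs⟩ := summable_iff_vanishing_norm.1 ((memℓp_gen_iff hp0).1 hy.1) (ε ^ p.toReal)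
      (by positivity)
    refine ⟨s.sup id + 1, fun α hα F hF => ?_⟩
    have hdisj : Disjoint F s := Finset.disjoint_left.2 fun n hnF hns => by
      have h1 := hF n hnF
      have h2 : n ≤ s.sup id := Finset.le_sup (f := id) hns
      omega
    have h3 : ∑ n ∈ F, ‖y n‖ ^ p.toReal ≤ ε ^ p.toReal := (le_abs_self _).trans (hs F hdisj).le
    refine (Real.inner_le_Lp_mul_Lq_of_nonneg F hconj (fun _ _ => norm_nonneg _)
      fun _ _ => norm_nonneg _).trans ?_
    calc _ ≤ 1 * (ε ^ p.toReal) ^ (1 / p.toReal) := by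
          gcongr
          exact Real.rpow_le_one (by positivity) (hα F) (by positivity)
      _ = ε := by rw [one_mul, one_div, Real.rpow_rpow_inv hε.le hp0.ne']

variable [NormedSpace 𝕜 Y]

theorem lpBallImage_eq {p : ℝ≥0∞} (hp : 1 < p) (y : ℕ → Y) :
    lpBallImage 𝕜 p y =
      {v | ∃ α ∈ ellBall 𝕜 p.conjExponent.toReal, HasSum (fun n => α n • y n) v} := by
  have hq : 0 < p.conjExponent.toReal := by linarith [ENNReal.one_le_toReal_conjExponent hp]
  ext v
  constructor
  · rintro ⟨α, hα, hv⟩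
    refine ⟨α, fun F => (lp.sum_rpow_le_norm_rpow hq α F).trans ?_, hv⟩
    exact Real.rpow_le_one (lp.norm_nonneg' _) hα hq.le
  · rintro ⟨α, hα, hv⟩
    refine ⟨⟨α, memℓp_gen' hα⟩, ?_, hv⟩
    exact lp.norm_le_of_forall_sum_le hq zero_le_one (by simpa using! hα)

theorem StronglySummable.weaklySummable {p : ℝ≥0∞} (hp : 1 < p) {y : ℕ → Y}
    (hy : StronglySummable p y) : WeaklySummable 𝕜 p y := by
  refine fun f => ⟨?_, fun h => ?_⟩
  · rcases eq_or_ne p ∞ with rfl | hpt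
    · obtain ⟨C, hC⟩ := memℓp_infty_iff.1 hy.1
      refine memℓp_infty ⟨‖f‖ * C, ?_⟩
      rintro _ ⟨n, rfl⟩
      exact (f.le_opNorm _).trans (by gcongr; exact hC ⟨n, rfl⟩)
    · have hp0 : 0 < p.toReal := ENNReal.toReal_pos (by positivity) hpt
      refine memℓp_gen (((memℓp_gen_iff hp0).1 hy.1).mul_left (‖f‖ ^ p.toReal) |>.of_nonneg_of_le
        (fun n => by positivity) fun n => ?_)
      rw [← Real.mul_rpow (norm_nonneg _) (norm_nonneg _)]
      gcongr
      exact f.le_opNorm _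
  · simpa [Function.comp_def] using (f.continuous.tendsto 0).comp (hy.2 h)

/-- The finite partial sums of `E_y α` are bounded, uniformly in `α`, by the uniform boundedness
principle in `Y*`. -/
theorem WeaklySummable.exists_bound {p : ℝ≥0∞} (hp : 1 < p) {y : ℕ → Y}
    (hy : WeaklySummable 𝕜 p y) :
    ∃ M, ∀ α ∈ ellBall 𝕜 p.conjExponent.toReal, ∀ F : Finset ℕ, ‖∑ n ∈ F, α n • y n‖ ≤ M := by
  obtain ⟨M, hM⟩ := banach_steinhaus
    (g := fun a : ellBall 𝕜 p.conjExponent.toReal × Finset ℕ =>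
      NormedSpace.inclusionInDoubleDual 𝕜 Y (∑ n ∈ a.2, a.1.1 n • y n)) (fun f => by
    obtain ⟨N, hN⟩ := StronglySummable.exists_tail_le (𝕜 := 𝕜) hp (hy f) one_pos
    refine ⟨∑ n ∈ Finset.range N, ‖f (y n)‖ + 1, fun ⟨⟨α, hα⟩, F⟩ => ?_⟩
    rw [NormedSpace.dual_def, map_sum]
    simp only [map_smul, smul_eq_mul]
    refine (norm_sum_le _ _).trans ?_
    simp only [norm_mul]
    rw [← Finset.sum_filter_add_sum_filter_not F (fun n => n < N)]
    refine add_le_add ?_ (hN α hα _ fun n hn => by simpa using (Finset.mem_filter.1 hn).2)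
    calc ∑ n ∈ F with n < N, ‖α n‖ * ‖f (y n)‖ ≤ ∑ n ∈ F with n < N, ‖f (y n)‖ := by
          refine Finset.sum_le_sum fun n _ => mul_le_of_le_one_left (norm_nonneg _) ?_
          exact norm_apply_le_one_of_mem_ellBall (ENNReal.one_le_toReal_conjExponent hp) hα n
      _ ≤ _ := Finset.sum_le_sum_of_subset_of_nonneg
          (fun n hn => by simpa using (Finset.mem_filter.1 hn).2) fun _ _ _ => norm_nonneg _)
  refine ⟨M, fun α hα F => ?_⟩
  exact ((NormedSpace.inclusionInDoubleDualLi (E := Y) 𝕜).norm_map _).symm.trans_le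
    (hM (⟨α, hα⟩, F))

/-- Convergence of `∑ αₙ yₙ` in norm: by homogeneity the bound on the partial sums makes blocks
of the series small, because the tails of `∑ ‖αₙ‖ ^ q` are. -/
theorem WeaklySummable.summable_smul [CompleteSpace Y] {p : ℝ≥0∞} (hp : 1 < p) {y : ℕ → Y}
    (hy : WeaklySummable 𝕜 p y) {α : ℕ → 𝕜} (hα : α ∈ ellBall 𝕜 p.conjExponent.toReal) :
    Summable fun n => α n • y n := by
  obtain ⟨M, hM⟩ := hy.exists_bound hp
  set q := p.conjExponent.toReal
  have hq : 1 ≤ q := ENNReal.one_le_toReal_conjExponent hp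
  have hM0 : 0 ≤ M := by simpa using hM α hα ∅
  have hsum : Summable fun n => ‖α n‖ ^ q :=
    summable_of_sum_le (fun n => by positivity) hα
  rw [summable_iff_vanishing_norm]
  intro ε hε
  -- `η` is small enough for `η * M < ε`
  set η := ε / (M + 1) with hη
  have hη0 : 0 < η := by positivity
  obtain ⟨s, hs⟩ := summable_iff_vanishing_norm.1 hsum (η ^ q) (by positivity)
  refine ⟨s, fun F hF => ?_⟩
  classical
  have hηk : (η : 𝕜) ≠ 0 := by exact_mod_cast hη0.ne'
  have hmem : (fun n => if n ∈ F then (η : 𝕜)⁻¹ * α n else 0) ∈ ellBall 𝕜 q := by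
    intro G
    have h1 : ∑ n ∈ F, ‖α n‖ ^ q ≤ η ^ q := (le_abs_self _).trans (hs F hF).le
    calc ∑ n ∈ G, ‖if n ∈ F then (η : 𝕜)⁻¹ * α n else 0‖ ^ q
        = ∑ n ∈ G, if n ∈ F then (η⁻¹) ^ q * ‖α n‖ ^ q else 0 := by
          refine Finset.sum_congr rfl fun n _ => ?_
          split_ifs
          · rw [norm_mul, norm_inv, RCLike.norm_ofReal, abs_of_pos hη0,
              Real.mul_rpow (by positivity) (by positivity)]
          · rw [norm_zero, Real.zero_rpow (by linarith)]
      _ = ∑ n ∈ G ∩ F, (η⁻¹) ^ q * ‖α n‖ ^ q := by rw [Finset.sum_ite_mem]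
      _ ≤ ∑ n ∈ F, (η⁻¹) ^ q * ‖α n‖ ^ q :=
          Finset.sum_le_sum_of_subset_of_nonneg Finset.inter_subset_right
            fun _ _ _ => by positivity
      _ = (η⁻¹) ^ q * ∑ n ∈ F, ‖α n‖ ^ q := by rw [Finset.mul_sum]
      _ ≤ (η⁻¹) ^ q * η ^ q := by gcongr
      _ = 1 := by
          rw [← Real.mul_rpow (by positivity) hη0.le, inv_mul_cancel₀ hη0.ne', Real.one_rpow]
  have h2 : ∑ n ∈ F, α n • y n =
      (η : 𝕜) • ∑ n ∈ F, (if n ∈ F then (η : 𝕜)⁻¹ * α n else 0) • y n := by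
    rw [Finset.smul_sum]
    refine Finset.sum_congr rfl fun n hn => ?_
    rw [if_pos hn, smul_smul, mul_inv_cancel_left₀ hηk]
  rw [h2, norm_smul, RCLike.norm_ofReal, abs_of_pos hη0]
  calc η * _ ≤ η * M := by gcongr; exact hM _ hmem F
    _ < η * (M + 1) := by gcongr; linarith
    _ = ε := div_mul_cancel₀ _ (by positivity)

theorem lpBallImage_eq_image [CompleteSpace Y] {p : ℝ≥0∞} (hp : 1 < p) {y : ℕ → Y}
    (hy : WeaklySummable 𝕜 p y) :
    lpBallImage 𝕜 p y =
      (fun α : ℕ → 𝕜 => ∑' n, α n • y n) '' ellBall 𝕜 p.conjExponent.toReal := by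
  rw [lpBallImage_eq hp]
  ext v
  exact ⟨fun ⟨α, hα, hv⟩ => ⟨α, hα, hv.tsum_eq⟩, fun ⟨α, hα, hv⟩ =>
    ⟨α, hα, hv ▸ (hy.summable_smul hp hα).hasSum⟩⟩

theorem StronglySummable.continuousOn_tsum [CompleteSpace Y] {p : ℝ≥0∞} (hp : 1 < p) {y : ℕ → Y}
    (hy : StronglySummable p y) :
    ContinuousOn (fun α : ℕ → 𝕜 => ∑' n, α n • y n) (ellBall 𝕜 p.conjExponent.toReal) := by
  have hunif : TendstoUniformlyOn (fun N (α : ℕ → 𝕜) => ∑ n ∈ Finset.range N, α n • y n)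
      (fun α => ∑' n, α n • y n) atTop (ellBall 𝕜 p.conjExponent.toReal) := by
    rw [Metric.tendstoUniformlyOn_iff]
    intro ε hε
    obtain ⟨N, hN⟩ := hy.exists_tail_le (𝕜 := 𝕜) hp (half_pos hε)
    filter_upwards [eventually_ge_atTop N] with M hM α hα
    refine lt_of_le_of_lt ?_ (half_lt_self hε)
    have hs := ((hy.weaklySummable hp).summable_smul hp hα).hasSum.tendsto_sum_nat
    refine le_of_tendsto (hs.dist tendsto_const_nhds) ?_
    filter_upwards [eventually_ge_atTop M] with m hm
    rw [dist_eq_norm, ← Finset.sum_Ico_eq_sub _ hm]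
    refine (norm_sum_le _ _).trans ?_
    simp only [norm_smul]
    exact hN α hα _ fun n hn => hM.trans (Finset.mem_Ico.1 hn).1
  refine hunif.continuousOn (Frequently.of_forall fun N => Continuous.continuousOn ?_)
  fun_prop

theorem StronglySummable.isCompact_lpBallImage [CompleteSpace Y] {p : ℝ≥0∞} (hp : 1 < p)
    {y : ℕ → Y} (hy : StronglySummable p y) : IsCompact (lpBallImage 𝕜 p y) := by
  rw [lpBallImage_eq_image hp (hy.weaklySummable hp)]
  exact (isCompact_ellBall (ENNReal.one_le_toReal_conjExponent hp)).image_of_continuousOn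
    (hy.continuousOn_tsum hp)

/-- Each `f ∘ E_y` is continuous on the unit ball of `ℓ_q` with the pointwise topology, by the
strong case applied to the scalar sequence `f (yₙ)`. -/
theorem WeaklySummable.isCompact_toWeakSpace_lpBallImage [CompleteSpace Y] {p : ℝ≥0∞} (hp : 1 < p)
    {y : ℕ → Y} (hy : WeaklySummable 𝕜 p y) :
    IsCompact (toWeakSpace 𝕜 Y '' lpBallImage 𝕜 p y) := by
  rw [lpBallImage_eq_image hp hy, image_image]
  refine (isCompact_ellBall (ENNReal.one_le_toReal_conjExponent hp)).image_of_continuousOn ?_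
  rw [continuousOn_iff_continuous_domRestrict]
  refine WeakBilin.continuous_of_continuous_eval _ fun f => ?_
  have h := continuousOn_iff_continuous_domRestrict.1
    (StronglySummable.continuousOn_tsum (𝕜 := 𝕜) hp (hy f))
  refine h.congr fun α => ?_
  exact (f.map_tsum (hy.summable_smul hp α.2)).symm ▸ by simp

end Sequences

/-! ### Scaling of the sequence `y` -/

section Scaling

variable {𝕜 : Type v} [RCLike 𝕜]
variable {Y Z : Type u} [NormedAddCommGroup Y] [NormedSpace 𝕜 Y]
  [NormedAddCommGroup Z] [NormedSpace 𝕜 Z]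

theorem smul_mem_lpBallImage {p : ℝ≥0∞} {y : ℕ → Y} {v : Y} (hv : v ∈ lpBallImage 𝕜 p y) (c : 𝕜) :
    c • v ∈ lpBallImage 𝕜 p (c • y) := by
  obtain ⟨α, hα, hs⟩ := hv
  refine ⟨α, hα, ?_⟩
  simpa only [Pi.smul_apply, smul_comm c] using hs.const_smul c

theorem StronglySummable.const_smul {p : ℝ≥0∞} {y : ℕ → Y} (hy : StronglySummable p y) (c : 𝕜) :
    StronglySummable p (c • y) :=
  ⟨hy.1.const_smul c, fun h => by simpa using! (hy.2 h).const_smul c⟩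

theorem WeaklySummable.const_smul {p : ℝ≥0∞} {y : ℕ → Y} (hy : WeaklySummable 𝕜 p y) (c : 𝕜) :
    WeaklySummable 𝕜 p (c • y) := by
  intro f
  have h : (fun n => f ((c • y) n)) = c • fun n => f (y n) := by
    ext n; simp
  rw [h]
  exact StronglySummable.const_smul (hy f) c

theorem strongNorm_smul {p : ℝ≥0∞} (hp : 1 < p) {y : ℕ → Y} (hy : StronglySummable p y) {c : ℝ}
    (hc : 0 ≤ c) :
    strongNorm p ((c : 𝕜) • y) (hy.const_smul (c : 𝕜)) = ENNReal.ofReal c * strongNorm p y hy := by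
  have h := lp.norm_const_smul (p := p) (c := (c : 𝕜)) (by positivity) ⟨y, hy.1⟩
  rw [RCLike.norm_ofReal, abs_of_nonneg hc] at h
  rw [strongNorm, strongNorm, ← ENNReal.ofReal_mul hc, ← h]
  rfl

theorem weakNorm_smul {p : ℝ≥0∞} (hp : 1 < p) {y : ℕ → Y} (hy : WeaklySummable 𝕜 p y) {c : ℝ}
    (hc : 0 ≤ c) :
    weakNorm 𝕜 p ((c : 𝕜) • y) (hy.const_smul (c : 𝕜)) = ENNReal.ofReal c * weakNorm 𝕜 p y hy := by
  simp only [weakNorm, ENNReal.mul_iSup]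
  refine iSup_congr fun f => iSup_congr fun _ => ?_
  refine Eq.trans ?_ (strongNorm_smul (𝕜 := 𝕜) hp (hy f) hc)
  rw [strongNorm]
  congr
  exact funext fun n => by simp

/-- If `T (B_Z)` lies in `lam • E_y (B_{ℓ_q})`, then `T` maps the ball of radius `r` into the image
associated with `(r * lam) • y`. -/
theorem image_closedBall_subset_lpBallImage {p : ℝ≥0∞} {y : ℕ → Y} {T : Z →L[𝕜] Y} {lam : ℝ}
    (hT : ∀ z ∈ Metric.closedBall (0 : Z) 1, ∃ v ∈ lpBallImage 𝕜 p y, T z = (lam : 𝕜) • v)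
    {r : ℝ} (hr : 0 < r) :
    T '' Metric.closedBall 0 r ⊆ lpBallImage 𝕜 p (((r * lam : ℝ) : 𝕜) • y) := by
  rintro _ ⟨z, hz, rfl⟩
  have hr' : (r : 𝕜) ≠ 0 := by exact_mod_cast hr.ne'
  obtain ⟨v, hv, hTv⟩ := hT ((r : 𝕜)⁻¹ • z) (by
    rw [mem_closedBall_zero_iff] at hz ⊢
    rwa [norm_smul, norm_inv, RCLike.norm_ofReal, abs_of_pos hr, inv_mul_le_one₀ hr])
  have : T z = ((r * lam : ℝ) : 𝕜) • v := by
    rw [RCLike.ofReal_mul, mul_smul, ← hTv, map_smul, smul_inv_smul₀ hr']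
  rw [this]
  exact smul_mem_lpBallImage hv _

end Scaling

/-! ### `p`-compact and weakly `p`-compact operators -/

section Operators

variable {𝕜 : Type v} [RCLike 𝕜]
variable {X Y Z : Type u} [NormedAddCommGroup X] [NormedSpace 𝕜 X]
  [NormedAddCommGroup Y] [NormedSpace 𝕜 Y] [NormedAddCommGroup Z] [NormedSpace 𝕜 Z]

theorem IsCompactOperator.isWeaklyCompactOperator {T : X →L[𝕜] Y} (hT : IsCompactOperator T) :
    IsWeaklyCompactOperator 𝕜 T := by
  obtain ⟨K, hK, hTK⟩ := hT.image_closedBall_subset_compact 1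
  exact ⟨_, hK.image (toWeakSpaceCLM 𝕜 Y).continuous, fun x hx => ⟨T x, hTK ⟨x, hx, rfl⟩, rfl⟩⟩

theorem IsWeaklyCompactOperator.clm_comp {W : Type u} [NormedAddCommGroup W] [NormedSpace 𝕜 W]
    {T : X →L[𝕜] Y} (hT : IsWeaklyCompactOperator 𝕜 T) (j : Y →L[𝕜] W) :
    IsWeaklyCompactOperator 𝕜 (j ∘L T) := by
  obtain ⟨K, hK, hTK⟩ := hT
  exact ⟨_, hK.image (WeakSpace.map j).continuous, fun x hx => ⟨_, hTK x hx, rfl⟩⟩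

theorem IsPCompactOperator.isCompactOperator [CompleteSpace Y] {p : ℝ≥0∞} (hp : 1 < p)
    {T : X →L[𝕜] Y} (hT : IsPCompactOperator 𝕜 p T) : IsCompactOperator T := by
  obtain ⟨y, hy, hTy⟩ := hT _ (Metric.isBounded_closedBall (x := 0) (r := 1))
  exact (isCompactOperator_iff_image_closedBall_subset_compact T.toLinearMap one_pos).2
    ⟨_, hy.isCompact_lpBallImage hp, hTy⟩

theorem IsWeaklyPCompactOperator.isWeaklyCompactOperator [CompleteSpace Y] {p : ℝ≥0∞} (hp : 1 < p)
    {T : X →L[𝕜] Y} (hT : IsWeaklyPCompactOperator 𝕜 p T) : IsWeaklyCompactOperator 𝕜 T := by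
  obtain ⟨y, hy, hTy⟩ := hT _ (Metric.isBounded_closedBall (x := 0) (r := 1))
  exact ⟨_, hy.isCompact_toWeakSpace_lpBallImage hp, fun x hx => ⟨_, hTy ⟨x, hx, rfl⟩, rfl⟩⟩

/-- If all the operators `j ∘ S`, with `j` bounded, extend from `X` to `Z` with a factor at most
`lam` in norm, then `S` has an extension that is dominated by `lam` times `S` in terms of all the
sets `E_y (B_{ℓ_q})` simultaneously. -/
theorem exists_extension_image_le [CompleteSpace X] [CompleteSpace Y] (i : X →ₗᵢ[𝕜] Z)
    {S : X →L[𝕜] Y} (hS : IsWeaklyCompactOperator 𝕜 S) {lam : ℝ} (hlam : 1 ≤ lam) {p : ℝ≥0∞}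
    (hp : 1 < p)
    (hext : ∀ (W : Type u) [NormedAddCommGroup W] [NormedSpace 𝕜 W] [CompleteSpace W]
      (j : Y →L[𝕜] W), ∃ T : Z →L[𝕜] W, (∀ x, T (i x) = j (S x)) ∧ ‖T‖ ≤ lam * ‖j ∘L S‖) :
    ∃ S' : Z →L[𝕜] Y, (∀ x, S' (i x) = S x) ∧
      ∀ y : ℕ → Y, WeaklySummable 𝕜 p y →
        S '' Metric.closedBall 0 1 ⊆ lpBallImage 𝕜 p y →
        ∀ r : ℝ, 0 < r →
          S' '' Metric.closedBall 0 r ⊆ lpBallImage 𝕜 p (((r * lam : ℝ) : 𝕜) • y) := by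
  obtain ⟨S', hS'i, hS'⟩ := exists_extension_of_approx i S hS (by linarith)
    fun ε hε => exists_approx_extension i S hlam hext hε
  refine ⟨S', hS'i, fun y hy hSy r hr => image_closedBall_subset_lpBallImage (fun z hz => ?_) hr⟩
  obtain ⟨v, ⟨w, hw, hwv⟩, hv⟩ := hS' _ (hy.isCompact_toWeakSpace_lpBallImage hp)
    (fun x hx => ⟨_, hSy ⟨x, hx, rfl⟩, rfl⟩) z hz
  obtain rfl := (toWeakSpace 𝕜 Y).injective hwv
  exact ⟨w, hw, hv⟩

end Operators

theorem corollaryC1 {𝕜 : Type v} [RCLike 𝕜]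
    {X Z : Type u} [NormedAddCommGroup X] [NormedSpace 𝕜 X] [CompleteSpace X]
    [NormedAddCommGroup Z] [NormedSpace 𝕜 Z] [CompleteSpace Z]
    (i : X →ₗᵢ[𝕜] Z) (hX : HasMAP 𝕜 X) (lam : ℝ) (hlam : 1 ≤ lam)
    (p : ℝ≥0∞) (hp : 1 < p) :
    ((∀ (Y : Type u) [NormedAddCommGroup Y] [NormedSpace 𝕜 Y] [CompleteSpace Y]
        (T : X →L[𝕜] Y), IsCompactOperator T →
          ∃ T' : Z →L[𝕜] Y, (∀ x, T' (i x) = T x) ∧ IsCompactOperator T' ∧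
            ‖T'‖ ≤ lam * ‖T‖) →
      ∀ (Y : Type u) [NormedAddCommGroup Y] [NormedSpace 𝕜 Y] [CompleteSpace Y]
        (S : X →L[𝕜] Y), IsPCompactOperator 𝕜 p S →
          ∃ S' : Z →L[𝕜] Y, (∀ x, S' (i x) = S x) ∧ IsPCompactOperator 𝕜 p S' ∧
            kappaNorm 𝕜 p S' ≤ ENNReal.ofReal lam * kappaNorm 𝕜 p S) ∧
    ((∀ (Y : Type u) [NormedAddCommGroup Y] [NormedSpace 𝕜 Y] [CompleteSpace Y]
        (T : X →L[𝕜] Y), IsWeaklyCompactOperator 𝕜 T →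
          ∃ T' : Z →L[𝕜] Y, (∀ x, T' (i x) = T x) ∧ IsWeaklyCompactOperator 𝕜 T' ∧
            ‖T'‖ ≤ lam * ‖T‖) →
      ∀ (Y : Type u) [NormedAddCommGroup Y] [NormedSpace 𝕜 Y] [CompleteSpace Y]
        (S : X →L[𝕜] Y), IsWeaklyPCompactOperator 𝕜 p S →
          ∃ S' : Z →L[𝕜] Y, (∀ x, S' (i x) = S x) ∧ IsWeaklyPCompactOperator 𝕜 p S' ∧
            omegaNorm 𝕜 p S' ≤ ENNReal.ofReal lam * omegaNorm 𝕜 p S) := by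
  have hlam0 : 0 < lam := by linarith
  have hlam' : ENNReal.ofReal lam ≠ 0 := by simpa using hlam0
  refine ⟨fun H Y _ _ _ S hS => ?_, fun H Y _ _ _ S hS => ?_⟩
  · have hSc := hS.isCompactOperator hp
    obtain ⟨S', hS'i, hS'⟩ := exists_extension_image_le i hSc.isWeaklyCompactOperator hlam hp
      fun W _ _ _ j => by
        obtain ⟨T, hT, -, hTn⟩ := H W (j ∘L S) (hSc.clm_comp j)
        exact ⟨T, hT, hTn⟩
    refine ⟨S', hS'i, fun A hA => ?_, ?_⟩
    · obtain ⟨y, hy, hSy⟩ := hS _ (Metric.isBounded_closedBall (x := 0) (r := 1))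
      obtain ⟨r, hr, hAr⟩ := hA.subset_closedBall_lt 0 0
      exact ⟨_, hy.const_smul _,
        (image_mono hAr).trans (hS' y (hy.weaklySummable hp) hSy r hr)⟩
    · simp only [kappaNorm, ENNReal.mul_iInf_of_ne hlam' ENNReal.ofReal_ne_top]
      refine le_iInf fun y => le_iInf fun hy => le_iInf fun hSy => ?_
      rw [← strongNorm_smul (𝕜 := 𝕜) hp hy hlam0.le]
      refine iInf_le_of_le _ (iInf_le_of_le _ (iInf_le_of_le ?_ le_rfl))
      simpa using hS' y (hy.weaklySummable hp) hSy 1 one_pos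
  · have hSc := hS.isWeaklyCompactOperator hp
    obtain ⟨S', hS'i, hS'⟩ := exists_extension_image_le i hSc hlam hp
      fun W _ _ _ j => by
        obtain ⟨T, hT, -, hTn⟩ := H W (j ∘L S) (hSc.clm_comp j)
        exact ⟨T, hT, hTn⟩
    refine ⟨S', hS'i, fun A hA => ?_, ?_⟩
    · obtain ⟨y, hy, hSy⟩ := hS _ (Metric.isBounded_closedBall (x := 0) (r := 1))
      obtain ⟨r, hr, hAr⟩ := hA.subset_closedBall_lt 0 0
      exact ⟨_, hy.const_smul _, (image_mono hAr).trans (hS' y hy hSy r hr)⟩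
    · simp only [omegaNorm, ENNReal.mul_iInf_of_ne hlam' ENNReal.ofReal_ne_top]
      refine le_iInf fun y => le_iInf fun hy => le_iInf fun hSy => ?_
      rw [← weakNorm_smul hp hy hlam0.le]
      refine iInf_le_of_le _ (iInf_le_of_le _ (iInf_le_of_le ?_ le_rfl))
      simpa using hS' y hy hSy 1 one_pos

end
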